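/- Let $G$ be a unimodular (Hausdorff, second countable, real finite-dimensional) Lie group with Haar measure $\mu_G$, let $\mathcal A$ be a unital $C^*$-algebra, let $U$ be a homomorphism from $G$ to the unitary group of $\mathcal A$, and let $\rho_0$ be a pure state of $\mathcal A$, with GNS representation $\pi_{\rho_0}$ on the Hilbert space $\mathcal H_{\rho_0}$. Suppose that the unitary representation $U_0=\pi_{\rho_0}\circ U$ of $G$ on $\mathcal H_{\rho_0}$ is strongly continuous and square integrable, i.e. it is irreducible and there are non-zero vectors $\phi,\psi\in\mathcal H_{\rho_0}$ with $\int_G|\langle\phi,U_0(g)\psi\rangle|^2\,d\mu_G(g)<\infty$. Then $U_0$ has a unique formal degree: there is exactly one real number $d>0$ such that, for all vectors, the functions $g\mapsto\langle\phi,U_0(g)\psi\rangle$ belong to $L^2(G,\mu_G)$ and $$\int_G\langle\phi_1,U_0(g)\psi_1\rangle\,\langle U_0(g)\psi_2,\phi_2\rangle\,d\mu_G(g)=d^{-1}\langle\phi_1,\phi_2\rangle\langle\psi_2,\psi_1\rangle$$ (inner products are linear in the second argument). Moreover, for every non-zero vector $\psi_0\in\mathcal H_{\rho_0}$, the family $\psi_g=U_0(g)\psi_0$,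 $g\in G$, is a tight frame with frame constant $d^{-1}\|\psi_0\|^2$: for every $\psi\in\mathcal H_{\rho_0}$ the function $g\mapsto\langle\psi,\psi_g\rangle$ is in $L^2(G,\mu_G)$ and $$\int_G|\langle\psi,\psi_g\rangle|^2\,d\mu_G(g)=d^{-1}\|\psi_0\|^2\,\|\psi\|^2 .$$ Its dual frame, i.e. the family $\psi^g=S^{-1}\psi_g$ where $S=\mathfrak F^*\mathfrak F$ is the metric operator and $\mathfrak F:\mathcal H_{\rho_0}\to L^2(G,\mu_G)$, $(\mathfrak F\psi)(g)=\langle\psi_g,\psi\rangle$, is the frame operator, is $$\psi^g=\frac{d}{\|\psi_0\|^2}\,U_0(g)\psi_0,\qquad g\in G.$$ -/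

import Mathlib

open MeasureTheory
open scoped InnerProductSpace ComplexOrder ContDiff Manifold

noncomputable section

namespace GroupTomography

section Frames

variable {M : Type*} [MeasurableSpace M]
  {H : Type*} [NormedAddCommGroup H] [InnerProductSpace ℂ H]

/-- The family `(f x)` of vectors of `H`, indexed by the measure space `(M, μ)`, is a frame with
lower bound `a` and upper bound `b`. -/
structure HasFrameBounds (μ : Measure M) (f : M → H) (a b : ℝ) : Prop where
  memLp : ∀ v : H, MemLp (fun x => ⟪v, f x⟫_ℂ) 2 μ
  pos : 0 < a
  le : a ≤ b
  lower : ∀ v : H, a * ‖v‖ ^ 2 ≤ ∫ x, ‖⟪v, f x⟫_ℂ‖ ^ 2 ∂μ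
  upper : ∀ v : H, ∫ x, ‖⟪v, f x⟫_ℂ‖ ^ 2 ∂μ ≤ b * ‖v‖ ^ 2

/-- A frame based on `(M, μ)`. -/
def IsFrame (μ : Measure M) (f : M → H) : Prop :=
  ∃ a b : ℝ, HasFrameBounds μ f a b

/-- A tight frame with frame constant `c`: both frame bounds are equal to `c`. -/
def IsTightFrame (μ : Measure M) (f : M → H) (c : ℝ) : Prop :=
  HasFrameBounds μ f c c

theorem IsTightFrame.isFrame {μ : Measure M} {f : M → H} {c : ℝ} (h : IsTightFrame μ f c) :
    IsFrame μ f :=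
  ⟨c, c, h⟩

theorem IsFrame.memLp_left {μ : Measure M} {f : M → H} (h : IsFrame μ f) (v : H) :
    MemLp (fun x => ⟪f x, v⟫_ℂ) 2 μ := by
  obtain ⟨a, b, hab⟩ := h
  have := (hab.memLp v).star
  refine this.congr_norm ?_ ?_
  · refine this.1.congr (Filter.Eventually.of_forall fun x => ?_)
    simp
  · exact Filter.Eventually.of_forall fun x => by simp

theorem norm_toLp_sq {μ : Measure M} {F : M → ℂ} (h : MemLp F 2 μ) :
    ‖h.toLp F‖ ^ 2 = ∫ x, ‖F x‖ ^ 2 ∂μ := by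
  have h1 := L2.inner_def (𝕜 := ℂ) (h.toLp F) (h.toLp F)
  rw [inner_self_eq_norm_sq_to_K] at h1
  have h2 : ∫ x, ⟪(h.toLp F) x, (h.toLp F) x⟫_ℂ ∂μ = ((∫ x, ‖F x‖ ^ 2 ∂μ : ℝ) : ℂ) := by
    rw [← integral_complex_ofReal]
    refine integral_congr_ae ?_
    filter_upwards [h.coeFn_toLp] with x hx
    rw [hx, inner_self_eq_norm_sq_to_K]
    norm_cast
  rw [h2] at h1
  have h3 : ((‖h.toLp F‖ ^ 2 : ℝ) : ℂ) = ((∫ x, ‖F x‖ ^ 2 ∂μ : ℝ) : ℂ) := by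
    rw [← h1]
    push_cast
    rfl
  exact Complex.ofReal_injective h3

/-- The frame operator `v ↦ (x ↦ ⟪f x, v⟫)`, a bounded operator from `H` to `L²(M, μ)`. -/
def IsFrame.frameOperator {μ : Measure M} {f : M → H} (h : IsFrame μ f) : H →L[ℂ] Lp ℂ 2 μ :=
  LinearMap.mkContinuousOfExistsBound
    { toFun := fun v => (h.memLp_left v).toLp (fun x => ⟪f x, v⟫_ℂ)
      map_add' := fun v w => by
        rw [← MemLp.toLp_add]
        exact MemLp.toLp_congr _ _ (Filter.Eventually.of_forall fun x => by simp)
      map_smul' := fun c v => by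
        rw [RingHom.id_apply, ← MemLp.toLp_const_smul]
        exact MemLp.toLp_congr _ _
          (Filter.Eventually.of_forall fun x => by simp) }
    (by
      obtain ⟨a, b, hab⟩ := id h
      refine ⟨Real.sqrt b, fun v => ?_⟩
      have hb : 0 ≤ b := hab.pos.le.trans hab.le
      refine (sq_le_sq₀ (norm_nonneg _) (by positivity)).mp ?_
      rw [mul_pow, Real.sq_sqrt hb]
      refine le_trans (le_of_eq ?_) (hab.upper v)
      refine (norm_toLp_sq (h.memLp_left v)).trans ?_
      simp_rw [norm_inner_symm])

variable [CompleteSpace H]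

/-- The metric operator `S = F* F` of a frame, where `F` is its frame operator. -/
def IsFrame.metricOperator {μ : Measure M} {f : M → H} (h : IsFrame μ f) : H →L[ℂ] H :=
  (ContinuousLinearMap.adjoint h.frameOperator).comp h.frameOperator

/-- The metric operator of a frame is invertible. -/
theorem IsFrame.isUnit_metricOperator {μ : Measure M} {f : M → H} (h : IsFrame μ f) :
    IsUnit h.metricOperator := by
  obtain ⟨a, b, hab⟩ := id h
  refine ContinuousLinearMap.isUnit_of_forall_le_norm_inner_map _ (c := ⟨a, hab.pos.le⟩)
    hab.pos fun v => ?_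
  have h1 : ⟪h.metricOperator v, v⟫_ℂ = ((‖h.frameOperator v‖ ^ 2 : ℝ) : ℂ) := by
    rw [IsFrame.metricOperator, ContinuousLinearMap.comp_apply,
      ContinuousLinearMap.adjoint_inner_left, inner_self_eq_norm_sq_to_K]
    push_cast
    rfl
  have h2 : ‖h.frameOperator v‖ ^ 2 = ∫ x, ‖⟪v, f x⟫_ℂ‖ ^ 2 ∂μ := by
    refine (norm_toLp_sq (h.memLp_left v)).trans ?_
    simp_rw [norm_inner_symm]
  rw [h1, Complex.norm_real, Real.norm_of_nonneg (by positivity), h2, mul_comm]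
  exact hab.lower v

/-- The dual frame `x ↦ S⁻¹ (f x)`, where `S` is the (invertible) metric operator. -/
def IsFrame.dualFrame {μ : Measure M} {f : M → H} (h : IsFrame μ f) : M → H :=
  fun x => Ring.inverse h.metricOperator (f x)

end Frames

section Representations

variable {G : Type*} [Group G] {H : Type*} [NormedAddCommGroup H] [InnerProductSpace ℂ H]
  [CompleteSpace H]

/-- Strong continuity of a unitary representation. -/
def IsStronglyContinuous [TopologicalSpace G] (π : G →* unitary (H →L[ℂ] H)) : Prop :=
  ∀ v : H, Continuous fun g => (π g : H →L[ℂ] H) v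

/-- (Topological) irreducibility: the space is nonzero and its only closed invariant subspaces are
the trivial ones. -/
def IsIrreducible (π : G →* unitary (H →L[ℂ] H)) : Prop :=
  Nontrivial H ∧ ∀ K : Submodule ℂ H, IsClosed (K : Set H) →
    (∀ g, ∀ v ∈ K, (π g : H →L[ℂ] H) v ∈ K) → K = ⊥ ∨ K = ⊤

/-- The coefficient function `g ↦ ⟪φ, π(g) ψ⟫`. -/
def coefficient (π : G →* unitary (H →L[ℂ] H)) (φ ψ : H) : G → ℂ :=
  fun g => ⟪φ, (π g : H →L[ℂ] H) ψ⟫_ℂ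

/-- A square integrable representation: an irreducible unitary representation with a square
integrable coefficient function, for some nonzero vectors. -/
def IsSquareIntegrable [MeasurableSpace G] (μ : Measure G) (π : G →* unitary (H →L[ℂ] H)) :
    Prop :=
  IsIrreducible π ∧ ∃ φ ψ : H, φ ≠ 0 ∧ ψ ≠ 0 ∧ MemLp (coefficient π φ ψ) 2 μ

/-- `d` is the formal degree of `π` (with respect to the Haar measure `μ`): all the coefficient
functions are square integrable and satisfy the orthogonality relations with constant `d⁻¹`. -/
structure IsFormalDegree [MeasurableSpace G] (μ : Measure G) (π : G →* unitary (H →L[ℂ] H))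
    (d : ℝ) : Prop where
  pos : 0 < d
  memLp : ∀ φ ψ : H, MemLp (coefficient π φ ψ) 2 μ
  orthogonality : ∀ φ₁ ψ₁ φ₂ ψ₂ : H,
    ∫ g, ⟪φ₁, (π g : H →L[ℂ] H) ψ₁⟫_ℂ * ⟪(π g : H →L[ℂ] H) ψ₂, φ₂⟫_ℂ ∂μ
      = (d : ℂ)⁻¹ * (⟪φ₁, φ₂⟫_ℂ * ⟪ψ₂, ψ₁⟫_ℂ)

end Representations

section States

variable {A : Type*} [CStarAlgebra A]

variable (A) in
/-- The states of a unital C⋆-algebra: the normalized positive linear functionals. -/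
def stateSpace : Set (A →ₗ[ℂ] ℂ) :=
  {f | f 1 = 1 ∧ ∀ a : A, 0 ≤ f (star a * a)}

variable [PartialOrder A] [StarOrderedRing A]

/-- A pure state: an extreme point of the convex set of states. -/
def IsPureState (ρ : A →ₚ[ℂ] ℂ) : Prop :=
  ρ.toLinearMap ∈ Set.extremePoints ℝ (stateSpace A)

/-- The unitary representation `π_ρ ∘ U` of `G` on the GNS space of `ρ`. -/
def gnsRep {G : Type*} [Group G] (ρ : A →ₚ[ℂ] ℂ) (U : G →* unitary A) :
    G →* unitary (ρ.GNS →L[ℂ] ρ.GNS) :=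
  (Unitary.map { (ρ.gnsStarAlgHom : A →* (ρ.GNS →L[ℂ] ρ.GNS)) with
    map_star' := map_star ρ.gnsStarAlgHom }).toMonoidHom.comp U

theorem gnsRep_apply {G : Type*} [Group G] (ρ : A →ₚ[ℂ] ℂ) (U : G →* unitary A) (g : G) :
    (gnsRep ρ U g : ρ.GNS →L[ℂ] ρ.GNS) = ρ.gnsStarAlgHom (U g : A) :=
  rfl

end States

end GroupTomography

end

/-! Fix `ψ` with one square integrable coefficient. The map sending `φ` to `g ↦ ⟪π g ψ, φ⟫` is
closed, so its graph is a Hilbert space, on which `G` acts unitarily by left invariance of `μ`. If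
`P` is the projection of the graph to `H`, then `P P*` commutes with `π`; by Schur's lemma it is a
scalar `c`, non-zero because the graph is. Hence `P` is onto, so every `φ` has a square integrable
coefficient, and its `L²` norm squared is `(c⁻¹ - 1) ‖φ‖²`
(`IsIrreducible.exists_integral_norm_sq_eq`). Unimodularity makes `μ` inversion invariant, which
swaps the roles of `φ` and `ψ`, so the norm squared is `k ‖φ‖² ‖ψ‖²`. Polarizing in each argument
gives orthogonality with `d = k⁻¹`. The diagonal case is the tight frame identity, for which the
metric operator is a scalar. -/

noncomputable section

namespace GroupTomography

/-! ### Unitary representations and Schur's lemma. -/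

section UnitaryRepresentations

variable {G : Type*} [Group G] {H : Type*} [NormedAddCommGroup H] [InnerProductSpace ℂ H]
  [CompleteSpace H] (π : G →* unitary (H →L[ℂ] H))

theorem rep_one_apply (v : H) : (π 1 : H →L[ℂ] H) v = v := by
  simp

theorem rep_mul_apply (g h : G) (v : H) :
    (π (g * h) : H →L[ℂ] H) v = (π g : H →L[ℂ] H) ((π h : H →L[ℂ] H) v) := by
  simp

theorem rep_apply_inv_self (g : G) (v : H) :
    (π g : H →L[ℂ] H) ((π g⁻¹ : H →L[ℂ] H) v) = v := by
  rw [← rep_mul_apply, mul_inv_cancel, rep_one_apply]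

theorem inner_rep_rep (g : G) (v w : H) :
    ⟪(π g : H →L[ℂ] H) v, (π g : H →L[ℂ] H) w⟫_ℂ = ⟪v, w⟫_ℂ :=
  ContinuousLinearMap.inner_map_map_of_mem_unitary (π g).2 v w

theorem inner_rep_left (g : G) (v w : H) :
    ⟪(π g : H →L[ℂ] H) v, w⟫_ℂ = ⟪v, (π g⁻¹ : H →L[ℂ] H) w⟫_ℂ := by
  rw [← inner_rep_rep π g v, rep_apply_inv_self]

theorem inner_rep_right (g : G) (v w : H) :
    ⟪v, (π g : H →L[ℂ] H) w⟫_ℂ = ⟪(π g⁻¹ : H →L[ℂ] H) v, w⟫_ℂ := by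
  rw [inner_rep_left, inv_inv]

variable {π}

/-- The kernel of `S` is a closed invariant subspace containing the range of `T`. -/
theorem IsIrreducible.eq_zero_or_eq_zero_of_mul_eq_zero (hπ : IsIrreducible π)
    {S T : H →L[ℂ] H} (hS : ∀ g, Commute S (π g : H →L[ℂ] H)) (hST : S * T = 0) :
    S = 0 ∨ T = 0 := by
  rcases hπ.2 (LinearMap.ker (S : H →ₗ[ℂ] H)) S.isClosed_ker (fun g v hv => by
    have h1 : S ((π g : H →L[ℂ] H) v) = (π g : H →L[ℂ] H) (S v) :=
      congrArg (fun R : H →L[ℂ] H => R v) (hS g).eq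
    have h2 : S v = 0 := hv
    change S ((π g : H →L[ℂ] H) v) = 0
    rw [h1, h2, map_zero]) with h | h
  · right
    ext v
    have h1 : T v ∈ LinearMap.ker (S : H →ₗ[ℂ] H) :=
      congrArg (fun R : H →L[ℂ] H => R v) hST
    rw [h] at h1
    exact h1
  · left
    ext v
    have h1 : v ∈ LinearMap.ker (S : H →ₗ[ℂ] H) := h ▸ Submodule.mem_top
    exact h1

/-- Schur's lemma for bounded self-adjoint operators: one that commutes with an irreducible unitary
representation is a scalar. -/
theorem IsIrreducible.exists_eq_smul_one_of_isSelfAdjoint (hπ : IsIrreducible π)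
    {T : H →L[ℂ] H} (hT : IsSelfAdjoint T) (hcomm : ∀ g, Commute T (π g : H →L[ℂ] H)) :
    ∃ c : ℝ, T = c • (1 : H →L[ℂ] H) := by
  have := hπ.1
  obtain ⟨c, hc⟩ := ContinuousFunctionalCalculus.spectrum_nonempty (R := ℝ) T hT
  refine ⟨c, ?_⟩
  have key : ∀ x ∈ spectrum ℝ T, ∀ y ∈ spectrum ℝ T, ¬ x < y := by
    intro x hx y hy hxy
    -- Two functions with product zero, one positive at `y`, the other at `x`: two spectral points
    -- would give two non-zero operators with product zero, both commuting with `π`.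
    set f : ℝ → ℝ := fun t => max (t - (x + y) / 2) 0
    set k : ℝ → ℝ := fun t => max ((x + y) / 2 - t) 0
    have hf : Continuous f := by fun_prop
    have hk : Continuous k := by fun_prop
    have hfk : cfc f T * cfc k T = 0 := by
      rw [← cfc_mul f k T hf.continuousOn hk.continuousOn]
      have : (fun t => f t * k t) = fun _ => 0 := by
        funext t
        rcases le_total t ((x + y) / 2) with h | h
        · simp [f, h]
        · simp [k, h]
      rw [this]
      exact cfc_const_zero ℝ T
    have hzero : ∀ u : ℝ → ℝ, Continuous u → cfc u T = 0 → ∀ t ∈ spectrum ℝ T, u t = 0 := by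
      intro u hu h t ht
      rw [← cfc_const_zero ℝ T] at h
      exact (cfc_eq_cfc_iff_eqOn (a := T) hT hu.continuousOn continuousOn_const).1 h ht
    rcases hπ.eq_zero_or_eq_zero_of_mul_eq_zero (fun g => (hcomm g).cfc_real f) hfk with h | h
    · have h1 := hzero f hf h y hy
      have h2 : y - (x + y) / 2 ≤ f y := le_max_left _ _
      linarith
    · have h1 := hzero k hk h x hx
      have h2 : (x + y) / 2 - x ≤ k x := le_max_left _ _
      linarith
  have h1 : ∀ x ∈ spectrum ℝ T, x = c := fun x hx =>
    le_antisymm (not_lt.1 (key c hc x hx)) (not_lt.1 (key x hx c hc))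
  calc T = cfc (id : ℝ → ℝ) T := (cfc_id ℝ T hT).symm
    _ = cfc (fun _ : ℝ => c) T := cfc_congr fun x hx => h1 x hx
    _ = c • (1 : H →L[ℂ] H) := by rw [cfc_const c T hT, Algebra.algebraMap_eq_smul_one]

theorem star_coefficient (φ ψ : H) :
    star (coefficient π φ ψ) = fun g => ⟪(π g : H →L[ℂ] H) ψ, φ⟫_ℂ := by
  funext g
  exact inner_conj_symm _ _

/-- Coefficients swap their arguments under inversion, up to conjugation. -/
theorem star_coefficient_comp_inv (φ ψ : H) :
    star (coefficient π φ ψ ∘ Inv.inv) = coefficient π ψ φ := by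
  funext g
  change (starRingEnd ℂ) ⟪φ, (π g⁻¹ : H →L[ℂ] H) ψ⟫_ℂ = ⟪ψ, (π g : H →L[ℂ] H) φ⟫_ℂ
  rw [inner_conj_symm, inner_rep_right π g]

end UnitaryRepresentations

/-! ### Unimodularity and inversion. -/

section InversionInvariance

variable {G : Type*} [Group G] [TopologicalSpace G] [IsTopologicalGroup G]
  [LocallyCompactSpace G] [SecondCountableTopology G] [MeasurableSpace G] [BorelSpace G]

/-- A bi-invariant Haar measure on a second countable locally compact group is invariant under
inversion. -/
theorem isInvInvariant_of_isMulRightInvariant (μ : Measure G) [μ.IsHaarMeasure]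
    [μ.IsMulRightInvariant] : μ.IsInvInvariant := by
  constructor
  have hfin : IsFiniteMeasureOnCompacts μ.inv := ⟨fun K hK => by
    rw [Measure.inv_apply]; exact hK.inv.measure_lt_top⟩
  let c : ENNReal := Measure.haarScalarFactor μ.inv μ
  have hc : μ.inv = c • μ := Measure.isMulLeftInvariant_eq_smul μ.inv μ
  -- Inverting twice is the identity and each inversion contributes a factor `c`.
  have μeq : μ = c ^ 2 • μ := by
    conv_lhs => rw [← Measure.inv_inv μ, hc]
    rw [Measure.inv_def, Measure.map_smul, ← Measure.inv_def, hc, smul_smul, pow_two]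
  have K : TopologicalSpace.PositiveCompacts G := Classical.arbitrary _
  have h1 : c ^ 2 * μ K = 1 ^ 2 * μ K := by
    conv_rhs => rw [μeq]
    simp
  have h2 : c ^ 2 = 1 ^ 2 :=
    (ENNReal.mul_left_inj (Measure.measure_pos_of_nonempty_interior _ K.interior_nonempty).ne'
      K.isCompact.measure_lt_top.ne).1 h1
  have h3 : c = 1 := (ENNReal.pow_right_strictMono two_ne_zero).injective h2
  rw [hc, h3, one_smul]

end InversionInvariance

/-! ### The graph of the coefficient map as a Hilbert space. -/

section CoefficientGraph

variable {G : Type*} [Group G] [MeasurableSpace G] {H : Type*} [NormedAddCommGroup H]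
  [InnerProductSpace ℂ H] [CompleteSpace H]

/-- The graph of the (possibly unbounded) operator from `H` to `L²(G, μ)` that sends `φ` to
`g ↦ ⟪π(g) ψ, φ⟫`. -/
def coefficientGraph (μ : Measure G) (π : G →* unitary (H →L[ℂ] H)) (ψ : H) :
    Submodule ℂ (WithLp 2 (H × Lp ℂ 2 μ)) where
  carrier := {p | ∀ᵐ g ∂μ, p.snd g = ⟪(π g : H →L[ℂ] H) ψ, p.fst⟫_ℂ}
  zero_mem' := by
    filter_upwards [Lp.coeFn_zero ℂ 2 μ] with g hg
    simpa using hg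
  add_mem' := fun {p q} hp hq => by
    filter_upwards [hp, hq, Lp.coeFn_add p.snd q.snd] with g hgp hgq hg
    rw [WithLp.add_snd, hg, Pi.add_apply, hgp, hgq, WithLp.add_fst, inner_add_right]
  smul_mem' := fun c p hp => by
    filter_upwards [hp, Lp.coeFn_smul c p.snd] with g hgp hg
    rw [WithLp.smul_snd, hg, Pi.smul_apply, hgp, WithLp.smul_fst, inner_smul_right, smul_eq_mul]

variable {μ : Measure G} {π : G →* unitary (H →L[ℂ] H)} {ψ : H}

theorem mem_coefficientGraph {p : WithLp 2 (H × Lp ℂ 2 μ)} :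
    p ∈ coefficientGraph μ π ψ ↔ ∀ᵐ g ∂μ, p.snd g = ⟪(π g : H →L[ℂ] H) ψ, p.fst⟫_ℂ :=
  Iff.rfl

/-- An `L²` limit is an a.e. limit along a subsequence, while the inner products converge at every
`g`. -/
theorem isClosed_coefficientGraph :
    IsClosed (coefficientGraph μ π ψ : Set (WithLp 2 (H × Lp ℂ 2 μ))) := by
  refine IsSeqClosed.isClosed fun u p hu hup => ?_
  have h1 : Filter.Tendsto (fun n => (u n).fst) Filter.atTop (nhds p.fst) :=
    ((WithLp.fstL 2 ℂ H (Lp ℂ 2 μ)).continuous.tendsto p).comp hup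
  have h2 : Filter.Tendsto (fun n => (u n).snd) Filter.atTop (nhds p.snd) :=
    ((WithLp.sndL 2 ℂ H (Lp ℂ 2 μ)).continuous.tendsto p).comp hup
  obtain ⟨ns, hns, hae⟩ := (tendstoInMeasure_of_tendsto_Lp h2).exists_seq_tendsto_ae
  have h3 : ∀ᵐ g ∂μ, ∀ n, (u n).snd g = ⟪(π g : H →L[ℂ] H) ψ, (u n).fst⟫_ℂ :=
    ae_all_iff.2 fun n => hu n
  refine mem_coefficientGraph.2 ?_
  filter_upwards [hae, h3] with g hg hg3
  refine tendsto_nhds_unique hg ?_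
  simp_rw [hg3]
  exact tendsto_const_nhds.inner (h1.comp hns.tendsto_atTop)

instance : CompleteSpace (coefficientGraph μ π ψ) :=
  isClosed_coefficientGraph.completeSpace_coe

theorem memLp_of_mem_coefficientGraph {p : WithLp 2 (H × Lp ℂ 2 μ)}
    (hp : p ∈ coefficientGraph μ π ψ) :
    MemLp (fun g => ⟪(π g : H →L[ℂ] H) ψ, p.fst⟫_ℂ) 2 μ :=
  (Lp.memLp p.snd).ae_eq hp

theorem exists_mem_coefficientGraph {φ : H}
    (hφ : MemLp (fun g => ⟪(π g : H →L[ℂ] H) ψ, φ⟫_ℂ) 2 μ) :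
    ∃ p : coefficientGraph μ π ψ, p.1.fst = φ :=
  ⟨⟨WithLp.toLp 2 (φ, hφ.toLp _), hφ.coeFn_toLp⟩, rfl⟩

theorem coefficientGraph_ext {p q : coefficientGraph μ π ψ} (h : p.1.fst = q.1.fst) : p = q := by
  refine Subtype.ext ?_
  have h2 : p.1.snd = q.1.snd := by
    refine Lp.ext ?_
    filter_upwards [mem_coefficientGraph.1 p.2, mem_coefficientGraph.1 q.2] with g hp hq
    rw [hp, hq, h]
  exact WithLp.ofLp_injective 2 (Prod.ext h h2)

theorem inner_coefficientGraph (p q : coefficientGraph μ π ψ) :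
    ⟪p, q⟫_ℂ = ⟪p.1.fst, q.1.fst⟫_ℂ +
      ∫ g, ⟪⟪(π g : H →L[ℂ] H) ψ, p.1.fst⟫_ℂ, ⟪(π g : H →L[ℂ] H) ψ, q.1.fst⟫_ℂ⟫_ℂ ∂μ := by
  rw [Submodule.coe_inner, WithLp.prod_inner_apply]
  congr 1
  rw [L2.inner_def]
  refine integral_congr_ae ?_
  filter_upwards [mem_coefficientGraph.1 p.2, mem_coefficientGraph.1 q.2] with g hp hq
  have hp' : p.1.ofLp.2 g = _ := hp
  have hq' : q.1.ofLp.2 g = _ := hq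
  rw [hp', hq']

/-- Moving `φ` by `π h` translates its coefficient function by `h⁻¹` on the left. -/
theorem exists_rep_coefficientGraph [MeasurableMul G] [μ.IsMulLeftInvariant] (h : G)
    (p : coefficientGraph μ π ψ) :
    ∃ q : coefficientGraph μ π ψ, q.1.fst = (π h : H →L[ℂ] H) p.1.fst := by
  refine exists_mem_coefficientGraph ?_
  convert (memLp_of_mem_coefficientGraph p.2).comp_measurePreserving
    (measurePreserving_mul_left μ h⁻¹) using 1
  funext g
  simp [inner_rep_right π h]

theorem inner_coefficientGraph_of_rep [MeasurableMul G] [μ.IsMulLeftInvariant] (h : G)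
    {p q p' q' : coefficientGraph μ π ψ} (hp : p'.1.fst = (π h : H →L[ℂ] H) p.1.fst)
    (hq : q'.1.fst = (π h : H →L[ℂ] H) q.1.fst) : ⟪p', q'⟫_ℂ = ⟪p, q⟫_ℂ := by
  rw [inner_coefficientGraph, inner_coefficientGraph, hp, hq, inner_rep_rep]
  congr 1
  rw [← integral_mul_left_eq_self
    (fun g => ⟪⟪(π g : H →L[ℂ] H) ψ, p.1.fst⟫_ℂ, ⟪(π g : H →L[ℂ] H) ψ, q.1.fst⟫_ℂ⟫_ℂ) h⁻¹]
  congr 1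
  funext g
  rw [rep_mul_apply, inner_rep_right π h, inner_rep_right π h]

/-- The projection of the graph to `H`. -/
def coefficientGraphFst (μ : Measure G) (π : G →* unitary (H →L[ℂ] H)) (ψ : H) :
    coefficientGraph μ π ψ →L[ℂ] H :=
  (WithLp.fstL 2 ℂ H (Lp ℂ 2 μ)).comp (coefficientGraph μ π ψ).subtypeL

/-- The projection intertwines two unitary actions, hence so does its adjoint. -/
theorem adjoint_coefficientGraphFst_rep [MeasurableMul G] [μ.IsMulLeftInvariant] (h : G) (x : H) :
    ((ContinuousLinearMap.adjoint (coefficientGraphFst μ π ψ)) ((π h : H →L[ℂ] H) x)).1.fst =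
      (π h : H →L[ℂ] H) ((ContinuousLinearMap.adjoint (coefficientGraphFst μ π ψ)) x).1.fst := by
  obtain ⟨p', hp'⟩ := exists_rep_coefficientGraph h
    ((ContinuousLinearMap.adjoint (coefficientGraphFst μ π ψ)) x)
  rw [← hp']
  congr 2
  refine ext_inner_right ℂ fun q' => ?_
  obtain ⟨q, hq⟩ := exists_rep_coefficientGraph h⁻¹ q'
  have hq' : q'.1.fst = (π h : H →L[ℂ] H) q.1.fst := by rw [hq, rep_apply_inv_self]
  rw [inner_coefficientGraph_of_rep h hp' hq', ContinuousLinearMap.adjoint_inner_left,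
    ContinuousLinearMap.adjoint_inner_left]
  change ⟪_, q'.1.fst⟫_ℂ = ⟪_, q.1.fst⟫_ℂ
  rw [hq', inner_rep_rep]

/-- If one nonzero `φ` has a square integrable coefficient with `ψ`, then all do, and the `L²` norm
is a multiple of the norm. -/
theorem IsIrreducible.exists_integral_norm_sq_eq [MeasurableMul G] [μ.IsMulLeftInvariant]
    (hπ : IsIrreducible π) {φ₀ : H} (hφ₀ : φ₀ ≠ 0)
    (h₀ : MemLp (fun g => ⟪(π g : H →L[ℂ] H) ψ, φ₀⟫_ℂ) 2 μ) :
    ∃ k : ℝ, ∀ φ : H, MemLp (fun g => ⟪(π g : H →L[ℂ] H) ψ, φ⟫_ℂ) 2 μ ∧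
      ∫ g, ‖⟪(π g : H →L[ℂ] H) ψ, φ⟫_ℂ‖ ^ 2 ∂μ = k * ‖φ‖ ^ 2 := by
  set P := coefficientGraphFst μ π ψ
  set Q := ContinuousLinearMap.adjoint P
  have hsa : IsSelfAdjoint (P ∘L Q) := by
    rw [ContinuousLinearMap.isSelfAdjoint_iff', ContinuousLinearMap.adjoint_comp,
      ContinuousLinearMap.adjoint_adjoint]
  obtain ⟨c, hc⟩ := hπ.exists_eq_smul_one_of_isSelfAdjoint hsa fun g => by
    ext x
    exact adjoint_coefficientGraphFst_rep g x
  have hcx : ∀ x, (Q x).1.fst = c • x := fun x => congrArg (fun R : H →L[ℂ] H => R x) hc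
  -- If `c = 0`, injectivity of `P` gives `Q φ₀ = 0`; pairing with the graph point over `φ₀` then
  -- yields `‖φ₀‖² = 0`.
  have hc0 : c ≠ 0 := by
    rintro rfl
    obtain ⟨p, hp⟩ := exists_mem_coefficientGraph h₀
    have h1 : Q φ₀ = 0 := coefficientGraph_ext (by rw [hcx, zero_smul]; rfl)
    have h2 : ⟪Q φ₀, p⟫_ℂ = ⟪φ₀, p.1.fst⟫_ℂ := ContinuousLinearMap.adjoint_inner_left _ _ _
    rw [h1, inner_zero_left, hp] at h2
    exact hφ₀ (inner_self_eq_zero.1 h2.symm)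
  -- The point over `φ` is `Q (c⁻¹ • φ)`, of squared graph norm `c⁻¹ ‖φ‖²`; the summand `‖φ‖²` from
  -- `H` is subtracted.
  refine ⟨c⁻¹ - 1, fun φ => ?_⟩
  have hfst : (Q (c⁻¹ • φ)).1.fst = φ := by rw [hcx, smul_inv_smul₀ hc0]
  set p := Q (c⁻¹ • φ)
  refine ⟨by simpa only [hfst] using memLp_of_mem_coefficientGraph p.2, ?_⟩
  have h1 : ⟪p, p⟫_ℂ = ⟪c⁻¹ • φ, p.1.fst⟫_ℂ :=
    ContinuousLinearMap.adjoint_inner_left P p (c⁻¹ • φ)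
  rw [inner_coefficientGraph, hfst, RCLike.real_smul_eq_coe_smul (K := ℂ), inner_smul_left] at h1
  simp only [inner_self_eq_norm_sq_to_K, RCLike.conj_ofReal] at h1
  have h2 : ∫ g, ((‖⟪(π g : H →L[ℂ] H) ψ, φ⟫_ℂ‖ : ℂ)) ^ 2 ∂μ =
      ((∫ g, ‖⟪(π g : H →L[ℂ] H) ψ, φ⟫_ℂ‖ ^ 2 ∂μ : ℝ) : ℂ) := by
    rw [← integral_complex_ofReal]
    push_cast
    rfl
  have h3 : ((‖φ‖ ^ 2 + ∫ g, ‖⟪(π g : H →L[ℂ] H) ψ, φ⟫_ℂ‖ ^ 2 ∂μ : ℝ) : ℂ) =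
      ((c⁻¹ * ‖φ‖ ^ 2 : ℝ) : ℂ) := by
    rw [Complex.ofReal_add, ← h2]
    push_cast at h1 ⊢
    exact h1
  linarith [Complex.ofReal_injective h3]

end CoefficientGraph

/-! ### Polarization of sesquilinear forms. -/

section Polarization

variable {H : Type*} [AddCommGroup H] [Module ℂ H]

/-- Polarization: a sesquilinear form is determined by its diagonal. -/
theorem eq_of_forall_diag_eq {B C : H →ₗ⋆[ℂ] H →ₗ[ℂ] ℂ} (h : ∀ x, B x x = C x x) : B = C := by
  ext x y
  have h1 := h (x + y)
  have h2 := h (x + Complex.I • y)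
  simp only [map_add, LinearMap.add_apply, map_smulₛₗ, LinearMap.smul_apply, smul_eq_mul,
    RingHom.id_apply, Complex.conj_I, h x, h y] at h1 h2
  -- These weights keep the `B x y` terms and cancel the `B y x` terms.
  linear_combination (1 / 2 : ℂ) * h1 + (-Complex.I / 2 : ℂ) * h2 +
    ((B x y - B y x - C x y + C y x) / 2) * Complex.I_sq

theorem inner_mul_inner_self_eq_norm_sq {E : Type*} [NormedAddCommGroup E] [InnerProductSpace ℂ E]
    (v w : E) :
    ⟪v, w⟫_ℂ * ⟪w, v⟫_ℂ = ((‖⟪v, w⟫_ℂ‖ ^ 2 : ℝ) : ℂ) := by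
  rw [← inner_conj_symm w v, RCLike.mul_conj]
  push_cast
  rfl

end Polarization

/-! ### Orthogonality relations and the formal degree. -/

section FormalDegree

variable {G : Type*} [Group G] [MeasurableSpace G] {H : Type*} [NormedAddCommGroup H]
  [InnerProductSpace ℂ H] [CompleteSpace H] {μ : Measure G} {π : G →* unitary (H →L[ℂ] H)}

theorem memLp_coefficient_iff {φ ψ : H} :
    MemLp (coefficient π φ ψ) 2 μ ↔ MemLp (fun g => ⟪(π g : H →L[ℂ] H) ψ, φ⟫_ℂ) 2 μ := by
  rw [← star_coefficient]
  exact ⟨fun h => h.star, fun h => by simpa using h.star⟩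

theorem integrable_coefficient_mul (hL : ∀ φ ψ : H, MemLp (coefficient π φ ψ) 2 μ)
    (φ₁ ψ₁ φ₂ ψ₂ : H) :
    Integrable (fun g => ⟪φ₁, (π g : H →L[ℂ] H) ψ₁⟫_ℂ * ⟪(π g : H →L[ℂ] H) ψ₂, φ₂⟫_ℂ) μ :=
  (hL φ₁ ψ₁).integrable_mul (memLp_coefficient_iff.1 (hL φ₂ ψ₂))

theorem memLp_coefficient_swap [MeasurableInv G] [μ.IsInvInvariant] {φ ψ : H}
    (h : MemLp (coefficient π φ ψ) 2 μ) : MemLp (coefficient π ψ φ) 2 μ := by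
  rw [← star_coefficient_comp_inv]
  exact (h.comp_measurePreserving (Measure.measurePreserving_inv μ)).star

theorem integral_norm_sq_coefficient_swap [MeasurableInv G] [μ.IsInvInvariant] (φ ψ : H) :
    ∫ g, ‖coefficient π φ ψ g‖ ^ 2 ∂μ = ∫ g, ‖coefficient π ψ φ g‖ ^ 2 ∂μ := by
  rw [← integral_inv_eq_self, ← star_coefficient_comp_inv]
  simp

theorem IsSquareIntegrable.exists_integral_norm_sq_eq [MeasurableMul G] [MeasurableInv G]
    [μ.IsMulLeftInvariant] [μ.IsInvInvariant] (hπ : IsSquareIntegrable μ π) :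
    (∀ φ ψ : H, MemLp (coefficient π φ ψ) 2 μ) ∧
      ∃ k : ℝ, ∀ φ ψ : H, ∫ g, ‖coefficient π φ ψ g‖ ^ 2 ∂μ = k * ‖φ‖ ^ 2 * ‖ψ‖ ^ 2 := by
  obtain ⟨hirr, φ₀, ψ₀, hφ₀, hψ₀, h₀⟩ := hπ
  have key : ∀ φ₀ ψ : H, φ₀ ≠ 0 → MemLp (coefficient π φ₀ ψ) 2 μ → ∃ k : ℝ, ∀ φ : H,
      MemLp (coefficient π φ ψ) 2 μ ∧ ∫ g, ‖coefficient π φ ψ g‖ ^ 2 ∂μ = k * ‖φ‖ ^ 2 := by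
    intro φ₀ ψ hφ₀ h₀
    obtain ⟨k, hk⟩ := hirr.exists_integral_norm_sq_eq hφ₀ (memLp_coefficient_iff.1 h₀)
    refine ⟨k, fun φ => ⟨memLp_coefficient_iff.2 (hk φ).1, ?_⟩⟩
    rw [← (hk φ).2]
    simp only [coefficient, norm_inner_symm]
  obtain ⟨k₀, hk₀⟩ := key φ₀ ψ₀ hφ₀ h₀
  -- The swap makes `ψ₀` a non-zero left vector valid for every `ψ`; comparing the pairs `(ψ₀, ψ)`
  -- and `(ψ, ψ₀)` later shows that `k ψ` is proportional to `‖ψ‖²`.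
  choose k hk using fun ψ => key ψ₀ ψ hψ₀ (memLp_coefficient_swap (hk₀ ψ).1)
  refine ⟨fun φ ψ => (hk ψ φ).1, k ψ₀ / ‖ψ₀‖ ^ 2, fun φ ψ => ?_⟩
  have h1 : ‖ψ₀‖ ≠ 0 := norm_ne_zero_iff.2 hψ₀
  have h2 : k ψ * ‖ψ₀‖ ^ 2 = k ψ₀ * ‖ψ‖ ^ 2 := by
    rw [← (hk ψ ψ₀).2, ← (hk ψ₀ ψ).2, integral_norm_sq_coefficient_swap]
  rw [(hk ψ φ).2]
  field_simp
  linear_combination ‖φ‖ ^ 2 * h2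

/-- The orthogonality relations follow from the norm identity by polarization in both arguments. -/
theorem integral_coefficient_mul_eq (hL : ∀ φ ψ : H, MemLp (coefficient π φ ψ) 2 μ) {k : ℝ}
    (hk : ∀ φ ψ : H, ∫ g, ‖coefficient π φ ψ g‖ ^ 2 ∂μ = k * ‖φ‖ ^ 2 * ‖ψ‖ ^ 2)
    (φ₁ ψ₁ φ₂ ψ₂ : H) :
    ∫ g, ⟪φ₁, (π g : H →L[ℂ] H) ψ₁⟫_ℂ * ⟪(π g : H →L[ℂ] H) ψ₂, φ₂⟫_ℂ ∂μ =
      (k : ℂ) * (⟪φ₁, φ₂⟫_ℂ * ⟪ψ₂, ψ₁⟫_ℂ) := by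
  have hI := integrable_coefficient_mul hL
  have hdiag : ∀ φ ψ : H,
      ∫ g, ⟪φ, (π g : H →L[ℂ] H) ψ⟫_ℂ * ⟪(π g : H →L[ℂ] H) ψ, φ⟫_ℂ ∂μ =
        (k : ℂ) * (⟪φ, φ⟫_ℂ * ⟪ψ, ψ⟫_ℂ) := by
    intro φ ψ
    simp_rw [inner_mul_inner_self_eq_norm_sq]
    rw [integral_complex_ofReal]
    have h := hk φ ψ
    simp only [coefficient] at h
    rw [h, inner_self_eq_norm_sq_to_K, inner_self_eq_norm_sq_to_K]
    push_cast
    rw [mul_assoc]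
    rfl
  -- Polarization in the `ψ` arguments with `φ` fixed; the `φ` arguments follow with `ψ₁`, `ψ₂`
  -- fixed.
  have hψ : ∀ φ ψ₁ ψ₂ : H,
      ∫ g, ⟪φ, (π g : H →L[ℂ] H) ψ₁⟫_ℂ * ⟪(π g : H →L[ℂ] H) ψ₂, φ⟫_ℂ ∂μ =
        (k : ℂ) * (⟪φ, φ⟫_ℂ * ⟪ψ₂, ψ₁⟫_ℂ) := by
    intro φ ψ₁ ψ₂
    let B : H →ₗ⋆[ℂ] H →ₗ[ℂ] ℂ := LinearMap.mk₂'ₛₗ (starRingEnd ℂ) (RingHom.id ℂ)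
      (fun x y => ∫ g, ⟪φ, (π g : H →L[ℂ] H) y⟫_ℂ * ⟪(π g : H →L[ℂ] H) x, φ⟫_ℂ ∂μ)
      (fun x x' y => by
        rw [← integral_add (hI _ _ _ _) (hI _ _ _ _)]
        simp only [map_add, inner_add_left, mul_add])
      (fun c x y => by
        rw [smul_eq_mul, ← integral_const_mul]
        simp only [map_smul, inner_smul_left, mul_left_comm])
      (fun x y y' => by
        rw [← integral_add (hI _ _ _ _) (hI _ _ _ _)]
        simp only [map_add, inner_add_right, add_mul])
      (fun c x y => by
        rw [RingHom.id_apply, smul_eq_mul, ← integral_const_mul]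
        simp only [map_smul, inner_smul_right, mul_assoc])
    have h : B = ((k : ℂ) * ⟪φ, φ⟫_ℂ) • innerₛₗ ℂ := eq_of_forall_diag_eq fun x => by
      rw [LinearMap.smul_apply, LinearMap.smul_apply, smul_eq_mul, innerₛₗ_apply_apply, mul_assoc]
      exact hdiag φ x
    have h' := congrArg (fun C : H →ₗ⋆[ℂ] H →ₗ[ℂ] ℂ => C ψ₂ ψ₁) h
    simp only [LinearMap.smul_apply, smul_eq_mul, innerₛₗ_apply_apply, mul_assoc] at h'
    exact h'
  let B : H →ₗ⋆[ℂ] H →ₗ[ℂ] ℂ := LinearMap.mk₂'ₛₗ (starRingEnd ℂ) (RingHom.id ℂ)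
    (fun x y => ∫ g, ⟪x, (π g : H →L[ℂ] H) ψ₁⟫_ℂ * ⟪(π g : H →L[ℂ] H) ψ₂, y⟫_ℂ ∂μ)
    (fun x x' y => by
      rw [← integral_add (hI _ _ _ _) (hI _ _ _ _)]
      simp only [inner_add_left, add_mul])
    (fun c x y => by
      rw [smul_eq_mul, ← integral_const_mul]
      simp only [inner_smul_left, mul_assoc])
    (fun x y y' => by
      rw [← integral_add (hI _ _ _ _) (hI _ _ _ _)]
      simp only [inner_add_right, mul_add])
    (fun c x y => by
      rw [RingHom.id_apply, smul_eq_mul, ← integral_const_mul]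
      simp only [inner_smul_right, mul_left_comm])
  have h : B = ((k : ℂ) * ⟪ψ₂, ψ₁⟫_ℂ) • innerₛₗ ℂ := eq_of_forall_diag_eq fun x => by
    rw [LinearMap.smul_apply, LinearMap.smul_apply, smul_eq_mul, innerₛₗ_apply_apply, mul_assoc,
      mul_comm ⟪ψ₂, ψ₁⟫_ℂ]
    exact hψ x ψ₁ ψ₂
  have h' := congrArg (fun C : H →ₗ⋆[ℂ] H →ₗ[ℂ] ℂ => C φ₁ φ₂) h
  simp only [LinearMap.smul_apply, smul_eq_mul, innerₛₗ_apply_apply, mul_assoc,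
    mul_comm ⟪ψ₂, ψ₁⟫_ℂ] at h'
  exact h'

theorem IsFormalDegree.integral_norm_sq {d : ℝ} (hd : IsFormalDegree μ π d) (φ ψ : H) :
    ∫ g, ‖⟪φ, (π g : H →L[ℂ] H) ψ⟫_ℂ‖ ^ 2 ∂μ = d⁻¹ * ‖ψ‖ ^ 2 * ‖φ‖ ^ 2 := by
  have h := hd.orthogonality φ ψ φ ψ
  simp_rw [inner_mul_inner_self_eq_norm_sq] at h
  rw [integral_complex_ofReal, inner_self_eq_norm_sq_to_K, inner_self_eq_norm_sq_to_K] at h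
  refine Complex.ofReal_injective (h.trans ?_)
  push_cast
  rw [mul_assoc, mul_comm (_ ^ 2) (_ ^ 2)]
  rfl

theorem IsFormalDegree.unique [Nontrivial H] {d d' : ℝ} (hd : IsFormalDegree μ π d)
    (hd' : IsFormalDegree μ π d') : d = d' := by
  obtain ⟨v, hv⟩ := exists_ne (0 : H)
  have h := (hd.integral_norm_sq v v).symm.trans (hd'.integral_norm_sq v v)
  have h1 : ‖v‖ ^ 2 ≠ 0 := pow_ne_zero 2 (norm_ne_zero_iff.2 hv)
  exact inv_injective (mul_right_cancel₀ h1 (mul_right_cancel₀ h1 h))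

/-- A strongly continuous square integrable representation of a unimodular group has a formal
degree. -/
theorem IsSquareIntegrable.exists_isFormalDegree [TopologicalSpace G]
    [OpensMeasurableSpace G] [MeasurableMul G] [MeasurableInv G]
    [μ.IsMulLeftInvariant] [μ.IsInvInvariant] [μ.IsOpenPosMeasure]
    (hcont : IsStronglyContinuous π) (hπ : IsSquareIntegrable μ π) :
    ∃ d, IsFormalDegree μ π d := by
  obtain ⟨hL, k, hk⟩ := hπ.exists_integral_norm_sq_eq
  have := hπ.1.1
  obtain ⟨v, hv⟩ := exists_ne (0 : H)
  have hv' : 0 < ‖v‖ := norm_pos_iff.2 hv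
  -- The integrand is continuous and equals `‖v‖⁴` at the identity, and `μ` charges open sets.
  have hpos : 0 < ∫ g, ‖coefficient π v v g‖ ^ 2 ∂μ := by
    have hc : Continuous fun g => ‖coefficient π v v g‖ ^ 2 :=
      ((continuous_const.inner (hcont v)).norm).pow 2
    refine integral_pos_of_integrable_nonneg_nonzero (x := 1) hc
      ((hL v v).integrable_norm_pow two_ne_zero) (fun g => by positivity) ?_
    simp [coefficient, hv]
  have hk0 : 0 < k := by
    rw [hk, mul_assoc] at hpos
    exact pos_of_mul_pos_left hpos (by positivity)
  refine ⟨k⁻¹, inv_pos.2 hk0, hL, fun φ₁ ψ₁ φ₂ ψ₂ => ?_⟩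
  rw [integral_coefficient_mul_eq hL hk]
  push_cast
  rw [inv_inv]

end FormalDegree

/-! ### Metric operator and dual of a tight frame. -/

section DualFrame

variable {M : Type*} [MeasurableSpace M] {μ : Measure M}
  {H : Type*} [NormedAddCommGroup H] [InnerProductSpace ℂ H] [CompleteSpace H]

/-- Both sides have the quadratic form `c ‖v‖²`, which determines an operator on a complex space. -/
theorem IsTightFrame.metricOperator_eq {f : M → H} {c : ℝ} (h : IsTightFrame μ f c) :
    h.isFrame.metricOperator = (c : ℂ) • (1 : H →L[ℂ] H) := by
  refine ContinuousLinearMap.coe_injective ((ext_inner_map _ _).1 fun v => ?_)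
  change ⟪h.isFrame.metricOperator v, v⟫_ℂ = ⟪(c : ℂ) • v, v⟫_ℂ
  have h2 : ‖h.isFrame.frameOperator v‖ ^ 2 = c * ‖v‖ ^ 2 := by
    refine (norm_toLp_sq (h.isFrame.memLp_left v)).trans ?_
    simp_rw [norm_inner_symm]
    exact le_antisymm (h.upper v) (h.lower v)
  rw [IsFrame.metricOperator, ContinuousLinearMap.comp_apply,
    ContinuousLinearMap.adjoint_inner_left, inner_self_eq_norm_sq_to_K, inner_smul_left,
    inner_self_eq_norm_sq_to_K, Complex.conj_ofReal]
  change ((‖h.isFrame.frameOperator v‖ : ℂ)) ^ 2 = (c : ℂ) * (‖v‖ : ℂ) ^ 2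
  exact_mod_cast h2

theorem IsTightFrame.dualFrame_eq {f : M → H} {c : ℝ} (h : IsTightFrame μ f c) (x : M) :
    h.isFrame.dualFrame x = c⁻¹ • f x := by
  have hc : (c : ℂ) ≠ 0 := Complex.ofReal_ne_zero.2 h.pos.ne'
  have h1 : Ring.inverse h.isFrame.metricOperator = (c : ℂ)⁻¹ • (1 : H →L[ℂ] H) := by
    rw [h.metricOperator_eq]
    rw [← one_mul (Ring.inverse _), eq_comm, Ring.eq_mul_inverse_iff_mul_eq _ _ _
      (h.metricOperator_eq ▸ h.isFrame.isUnit_metricOperator), smul_mul_smul_comm,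
      inv_mul_cancel₀ hc, one_smul, one_mul]
  rw [IsFrame.dualFrame, h1, RCLike.real_smul_eq_coe_smul (K := ℂ)]
  simp

end DualFrame

end GroupTomography

end

theorem mainTheorem7
    {n : ℕ} {G : Type*} [Group G] [TopologicalSpace G] [T2Space G] [SecondCountableTopology G]
    [ChartedSpace (EuclideanSpace ℝ (Fin n)) G] [LieGroup (𝓡 n) ∞ G]
    [MeasurableSpace G] [BorelSpace G]
    (μ : Measure G) [μ.IsHaarMeasure] [μ.IsMulRightInvariant]
    {A : Type*} [CStarAlgebra A] [PartialOrder A] [StarOrderedRing A]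
    (U : G →* unitary A) (ρ₀ : A →ₚ[ℂ] ℂ)
    (hpure : GroupTomography.IsPureState ρ₀)
    (hcont : GroupTomography.IsStronglyContinuous (GroupTomography.gnsRep ρ₀ U))
    (hsq : GroupTomography.IsSquareIntegrable μ (GroupTomography.gnsRep ρ₀ U)) :
    (∃! d : ℝ, GroupTomography.IsFormalDegree μ (GroupTomography.gnsRep ρ₀ U) d) ∧
    ∀ d : ℝ, GroupTomography.IsFormalDegree μ (GroupTomography.gnsRep ρ₀ U) d →
      ∀ ψ₀ : ρ₀.GNS, ψ₀ ≠ 0 →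
        ∃ hF : GroupTomography.IsTightFrame μ
            (fun g => (GroupTomography.gnsRep ρ₀ U g : ρ₀.GNS →L[ℂ] ρ₀.GNS) ψ₀)
            (d⁻¹ * ‖ψ₀‖ ^ 2),
          ∀ g : G, hF.isFrame.dualFrame g =
            (d / ‖ψ₀‖ ^ 2) • (GroupTomography.gnsRep ρ₀ U g : ρ₀.GNS →L[ℂ] ρ₀.GNS) ψ₀ := by
  have : IsTopologicalGroup G := topologicalGroup_of_lieGroup (𝓡 n) ∞
  have : LocallyCompactSpace G := ChartedSpace.locallyCompactSpace (EuclideanSpace ℝ (Fin n)) G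
  have : μ.IsInvInvariant := GroupTomography.isInvInvariant_of_isMulRightInvariant μ
  have := hsq.1.1
  refine ⟨?_, fun d hd ψ₀ hψ₀ => ?_⟩
  · obtain ⟨d, hd⟩ := hsq.exists_isFormalDegree hcont
    exact ⟨d, hd, fun d' hd' => hd'.unique hd⟩
  · have hψ₀' : 0 < ‖ψ₀‖ := norm_pos_iff.2 hψ₀
    have hF : GroupTomography.IsTightFrame μ
        (fun g => (GroupTomography.gnsRep ρ₀ U g : ρ₀.GNS →L[ℂ] ρ₀.GNS) ψ₀) (d⁻¹ * ‖ψ₀‖ ^ 2) :=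
      { memLp := fun v => hd.memLp v ψ₀
        pos := mul_pos (inv_pos.2 hd.pos) (by positivity)
        le := le_rfl
        lower := fun v => (hd.integral_norm_sq v ψ₀).ge
        upper := fun v => (hd.integral_norm_sq v ψ₀).le }
    refine ⟨hF, fun g => ?_⟩
    rw [hF.dualFrame_eq, mul_inv, inv_inv, div_eq_mul_inv]
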